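/- Let $C^*(F_\infty)$ be the full group $C^*$-algebra of the free group $F_\infty$ on countably infinitely many generators, and let $\mathcal B$ be a nuclear (not necessarily unital) $C^*$-algebra, i.e. for every $C^*$-algebra $\mathcal A$ the algebraic tensor product $\mathcal A\odot\mathcal B$ carries exactly one $C^*$-norm. Let $\rho_1$ be a state on $B(\ell^2)$, let $\rho_2$ be a state on $\mathcal B$, and let $\rho_1\otimes\rho_2$ be the product functional on $B(\ell^2)\odot\mathcal B$, determined by $(\rho_1\otimes\rho_2)(x\otimes b)=\rho_1(x)\rho_2(b)$. Let $\phi\colon C^*(F_\infty)\to B(\ell^2)$ be a bounded representation, i.e. a bounded linear multiplicative map (not assumed to be $*$-preserving or unital), with operator norm $\|\phi\|$. Then for all $n$, all $a_1,\dots,a_n\in C^*(F_\infty)$ and all $b_1,\dots,b_n\in\mathcal B$, the element $X=\sum_{i=1}^n\phi(a_i)\otimes b_i$ satisfies $(\rho_1\otimes\rho_2)(X^*X)\ge 0$ and $$\big((\rho_1\otimes\rho_2)(X^*X)\big)^{1/2}\le\|\phi\|^3\,\Big\|\sum_{i=1}^n a_i\otimes b_i\Big\|,$$ where the norm on the right is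 the unique $C^*$-norm on $C^*(F_\infty)\odot\mathcal B$. -/

import Mathlib

open scoped TensorProduct ComplexOrder ENNReal

noncomputable section

/-- The Hilbert space `ℓ²(ℕ)` over the complex numbers. -/
abbrev EllTwo : Type := lp (fun _ : ℕ => ℂ) 2

/-- The C⋆-algebra `B(ℓ²)` of bounded operators on `ℓ²(ℕ)`. -/
abbrev BEllTwo : Type := EllTwo →L[ℂ] EllTwo

instance : Nontrivial EllTwo :=
  ⟨lp.single 2 0 1, 0, fun h => by
    have h' : (lp.single 2 0 1 : EllTwo) 0 = 0 := by rw [h]; rfl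
    simp at h'⟩

/-! ### The full group C⋆-algebra of the free group on countably many generators -/

/-- The free group on countably infinitely many generators. -/
abbrev FreeGroupInf : Type := FreeGroup ℕ

/-- Unitary representations of the free group on `ℓ²(ℕ)`. The group being countable, each of its
cyclic unitary representations acts on a separable Hilbert space and hence is a subrepresentation
of one on `ℓ²(ℕ)`, so these determine the universal C⋆-norm of the group algebra. -/
abbrev FreeUnitaryRep : Type := FreeGroupInf →* unitary BEllTwo

/-- The C⋆-algebra of bounded families of operators, one operator on `ℓ²(ℕ)` for each unitary
representation of the free group, with the supremum norm. -/
abbrev FreeRepProduct : Type := lp (fun _ : FreeUnitaryRep => BEllTwo) ∞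

instance : CStarAlgebra FreeRepProduct where

theorem memℓp_freeUniversal (g : FreeGroupInf) :
    Memℓp (fun π : FreeUnitaryRep => (π g : BEllTwo)) ∞ :=
  memℓp_infty ⟨1, by
    rintro _ ⟨π, rfl⟩
    exact (CStarRing.norm_coe_unitary (π g)).le⟩

/-- The image of a group element in the universal representation: the family of its images under
all unitary representations. -/
def freeUniversal (g : FreeGroupInf) : FreeRepProduct :=
  ⟨fun π => (π g : BEllTwo), memℓp_freeUniversal g⟩

/-- The image of the group algebra in the universal representation, closed in norm. Its norm is
`‖∑ c_g g‖ = sup_π ‖∑ c_g π(g)‖`, that is, it is the completion of the group algebra for the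
universal C⋆-norm. -/
def fullFreeGroupSubalgebra : StarSubalgebra ℂ FreeRepProduct :=
  (StarAlgebra.adjoin ℂ (Set.range freeUniversal)).topologicalClosure

instance : CStarAlgebra fullFreeGroupSubalgebra :=
  StarSubalgebra.cstarAlgebra fullFreeGroupSubalgebra
    (h_closed := StarSubalgebra.isClosed_topologicalClosure _)

/-- The full group C⋆-algebra `C⋆(F_∞)`. -/
def CStarFreeInf : Type := fullFreeGroupSubalgebra

instance : CStarAlgebra CStarFreeInf := inferInstanceAs (CStarAlgebra fullFreeGroupSubalgebra)

/-! ### C⋆-norms on algebraic tensor products, nuclearity, states -/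

/-- `p` is a C⋆-norm on the algebraic tensor product `A ⊗ B`. -/
structure IsCStarNorm {A B : Type*} [NonUnitalCStarAlgebra A] [NonUnitalCStarAlgebra B]
    (p : Seminorm ℂ (A ⊗[ℂ] B)) : Prop where
  eq_zero_of_apply_eq_zero : ∀ x, p x = 0 → x = 0
  mul_le : ∀ x y, p (x * y) ≤ p x * p y
  star_mul_self : ∀ x, p (star x * x) = p x ^ 2

/-- A (not necessarily unital) C⋆-algebra `B` is nuclear if for every C⋆-algebra `A` there is
exactly one C⋆-norm on the algebraic tensor product `A ⊗ B`. It is enough to let `A` range over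
the algebras in `Type`: if two C⋆-norms differ at some `∑ aᵢ ⊗ bᵢ`, then they differ on the tensor
product of the separable C⋆-algebra generated by the `aᵢ` with `B`. -/
def IsNuclear (B : Type*) [NonUnitalCStarAlgebra B] : Prop :=
  ∀ (A : Type) [NonUnitalCStarAlgebra A], ∃! p : Seminorm ℂ (A ⊗[ℂ] B), IsCStarNorm p

/-- A state on a (not necessarily unital) C⋆-algebra: a positive linear functional of norm one. -/
structure IsState {A : Type*} [NonUnitalCStarAlgebra A] (ρ : A →L[ℂ] ℂ) : Prop where
  nonneg : ∀ x, 0 ≤ ρ (star x * x)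
  norm_eq_one : ‖ρ‖ = 1

/-- The product functional `ρ₁ ⊗ ρ₂`, determined by `a ⊗ b ↦ ρ₁ a * ρ₂ b`. -/
def tensorFunctional {A B : Type*} [NonUnitalCStarAlgebra A] [NonUnitalCStarAlgebra B]
    (ρ₁ : A →L[ℂ] ℂ) (ρ₂ : B →L[ℂ] ℂ) : A ⊗[ℂ] B →ₗ[ℂ] ℂ :=
  LinearMap.mul' ℂ ℂ ∘ₗ TensorProduct.map ρ₁.toLinearMap ρ₂.toLinearMap

end

/-! The core is a domination principle: for a bounded homomorphism `φ : A → C` with `A` unital and a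
positive functional `ρ` on `C`, there is a positive `G` on `A` with `G 1 ≤ ‖ρ‖‖φ‖²` and
`ρ(φ(a)⋆φ(a)) ≤ ‖φ‖² G(a⋆a)` (`exists_dominating_functional`). `G` is a weak-⋆ cluster point of `x ↦
ρ(φ(u)⋆φ(ux))` along unitaries `u` that nearly maximise `ρ(φ(u)⋆φ(u))`; moving `u` to `u(s ±
i√(1-s²))` and expanding to second order in `s` gives the inequality on selfadjoint elements, and
polar decomposition extends it to all `a`.

By the Schur product theorem the domination survives tensoring with `ρ₂`
(`tensorFunctional_map_le`). Nuclearity then bounds `(G ⊗ ρ₂)(Y⋆Y)` by `p(Y)² G(1)‖ρ₂‖`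
(`IsCStarNorm.tensorFunctional_le`): the left regular C⋆-seminorm `q` of a product functional
satisfies `q ≤ p`, because `p ⊔ q` is again a C⋆-norm. -/

open Filter Topology

/-! ### Positive sesquilinear forms and their Schur products. -/

section PositiveForm

variable {E F : Type*} [AddCommGroup E] [Module ℂ E] [AddCommGroup F] [Module ℂ F]

theorem star_apply_of_nonneg {S : E →ₗ⋆[ℂ] E →ₗ[ℂ] ℂ} (hS : ∀ x, 0 ≤ S x x) (x y : E) :
    star (S x y) = S y x := by
  have h1 := (Complex.nonneg_iff.1 (hS (x + y))).2
  have h2 := (Complex.nonneg_iff.1 (hS (x + Complex.I • y))).2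
  have hx := (Complex.nonneg_iff.1 (hS x)).2
  have hy := (Complex.nonneg_iff.1 (hS y)).2
  simp at h1 h2
  apply Complex.ext <;> simp <;> linarith

theorem posSemidef_of_nonneg {S : E →ₗ⋆[ℂ] E →ₗ[ℂ] ℂ} (hS : ∀ x, 0 ≤ S x x) {n : ℕ}
    (x : Fin n → E) : (Matrix.of fun i j => S (x i) (x j)).PosSemidef := by
  refine Matrix.posSemidef_iff_dotProduct_mulVec.2 ⟨?_, fun c => ?_⟩
  · ext i j
    simpa using star_apply_of_nonneg hS (x j) (x i)
  · convert hS (∑ i, c i • x i) using 1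
    simp only [dotProduct, Matrix.mulVec, Matrix.of_apply, map_sum, LinearMap.sum_apply,
      LinearMap.map_smulₛₗ, LinearMap.smul_apply, smul_eq_mul, Pi.star_apply, Finset.mul_sum,
      RingHom.id_apply, starRingEnd_apply]
    rw [Finset.sum_comm]
    refine Finset.sum_congr rfl fun i _ => Finset.sum_congr rfl fun j _ => ?_
    ring

/-- The Schur product theorem for positive sesquilinear forms. -/
theorem sum_sum_mul_nonneg {S : E →ₗ⋆[ℂ] E →ₗ[ℂ] ℂ} (hS : ∀ x, 0 ≤ S x x)
    {T : F →ₗ⋆[ℂ] F →ₗ[ℂ] ℂ} (hT : ∀ x, 0 ≤ T x x) {n : ℕ} (x : Fin n → E) (y : Fin n → F) :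
    0 ≤ ∑ i, ∑ j, S (x i) (x j) * T (y i) (y j) := by
  have h := ((posSemidef_of_nonneg hS x).hadamard
    (posSemidef_of_nonneg hT y)).dotProduct_mulVec_nonneg 1
  simpa [dotProduct, Matrix.mulVec, Matrix.hadamard] using h

variable {D : Type*} [NonUnitalRing D] [StarRing D] [Module ℂ D] [IsScalarTower ℂ D D]
  [SMulCommClass ℂ D D] [StarModule ℂ D]

/-- The sesquilinear form `(x, y) ↦ ω (f(x)⋆ f(y))`. -/
noncomputable def gramForm (ω : D →ₗ[ℂ] ℂ) (f : E →ₗ[ℂ] D) : E →ₗ⋆[ℂ] E →ₗ[ℂ] ℂ :=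
  LinearMap.mk₂'ₛₗ (starRingEnd ℂ) (RingHom.id ℂ) (fun x y => ω (star (f x) * f y))
    (fun x y z => by simp [add_mul]) (fun c x y => by simp [smul_mul_assoc])
    (fun x y z => by simp [mul_add]) (fun c x y => by simp [mul_smul_comm])

@[simp]
theorem gramForm_apply (ω : D →ₗ[ℂ] ℂ) (f : E →ₗ[ℂ] D) (x y : E) :
    gramForm ω f x y = ω (star (f x) * f y) := rfl

end PositiveForm

/-! ### Inequalities for positive functionals. -/

section PositiveFunctional

variable {A : Type*} [NonUnitalCStarAlgebra A] {ρ : A →L[ℂ] ℂ}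

theorem apply_nonneg_of_nonneg [PartialOrder A] [StarOrderedRing A]
    (hρ : ∀ x, 0 ≤ ρ (star x * x)) {a : A} (ha : 0 ≤ a) : 0 ≤ ρ a := by
  obtain ⟨x, rfl⟩ := CStarAlgebra.nonneg_iff_eq_star_mul_self.1 ha
  exact hρ x

/-- Conjugate `b⋆b ≤ ‖b‖²` by `x` and apply `ρ`. -/
theorem apply_star_mul_self_mul_le (hρ : ∀ x, 0 ≤ ρ (star x * x)) (b x : A) :
    ρ (star (b * x) * (b * x)) ≤ (‖b‖ ^ 2 : ℝ) * ρ (star x * x) := by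
  let _ := CStarAlgebra.spectralOrder A
  let _ := CStarAlgebra.spectralOrderedRing A
  have h := apply_nonneg_of_nonneg hρ (sub_nonneg.2
    (CStarAlgebra.star_left_conjugate_le_norm_smul (a := x) (b := star b * b)))
  rw [CStarRing.norm_star_mul_self, ← sq, map_sub, ← Complex.coe_smul, map_smul,
    smul_eq_mul, sub_nonneg] at h
  simpa [mul_assoc] using h

theorem re_apply_star_mul_self_le (x : A) :
    (ρ (star x * x)).re ≤ ‖ρ‖ * ‖x‖ ^ 2 := by
  refine (Complex.re_le_norm _).trans ((ρ.le_opNorm _).trans_eq ?_)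
  rw [CStarRing.norm_star_mul_self, sq]

end PositiveFunctional

/-! ### Unitaries and polar decomposition by functional calculus. -/

section FunctionalCalculus

variable {A : Type*} [CStarAlgebra A]

theorem abs_one_sub_sqrt_sub_le {x : ℝ} (hx : |x| ≤ 1) :
    |1 - √(1 - x ^ 2) - x ^ 2 / 2| ≤ |x| ^ 4 := by
  have h : x ^ 2 ≤ 1 := by rw [← sq_abs]; exact pow_le_one₀ (abs_nonneg x) hx
  have h1 := Real.sq_sqrt (sub_nonneg.2 h)
  have h0 := Real.sqrt_nonneg (1 - x ^ 2)
  have h4 : |x| ^ 4 = (x ^ 2) ^ 2 := by rw [← sq_abs x]; ring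
  rw [h4]
  set r := √(1 - x ^ 2)
  -- With `x² = 1 - r²` the error is `(1-r)²/2`, while `x⁴ = (1-r)²(1+r)²`.
  have e : 1 - r - x ^ 2 / 2 = (1 - r) ^ 2 / 2 := by linarith
  have hr : r ≤ 1 := by nlinarith [sq_nonneg x]
  have e2 : x ^ 2 = (1 - r) * (1 + r) := by linarith
  rw [e, abs_of_nonneg (by positivity), e2, mul_pow]
  nlinarith [sq_nonneg (1 - r), mul_nonneg (sq_nonneg (1 - r)) (by nlinarith : 0 ≤ (1 + r) ^ 2 - 1)]

/-- A selfadjoint contraction is the real part of a unitary, whose imaginary part is a square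
root that is controlled to fourth order. -/
theorem exists_unitary_add_smul (s : A) (hs : IsSelfAdjoint s) (hs1 : ‖s‖ ≤ 1) :
    ∃ c : A, s + Complex.I • c ∈ unitary A ∧ s - Complex.I • c ∈ unitary A ∧
      ‖1 - c - (1 / 2 : ℝ) • s ^ 2‖ ≤ ‖s‖ ^ 4 := by
  let _ := CStarAlgebra.spectralOrder A
  let _ := CStarAlgebra.spectralOrderedRing A
  obtain (_ | _) := subsingleton_or_nontrivial A
  · have h : ∀ x : A, x ∈ unitary A := fun x => by
      rw [Subsingleton.elim x 1]; exact one_mem _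
    exact ⟨1, h _, h _, by simp [Subsingleton.elim _ (0 : A)]⟩
  refine ⟨CFC.sqrt (1 - s ^ 2), hs.self_add_I_smul_cfcSqrt_sub_sq_mem_unitary s hs1, ?_, ?_⟩
  · rw [← selfAdjoint.star_coe_unitarySelfAddISMul ⟨s, hs⟩ hs1]
    exact (star (selfAdjoint.unitarySelfAddISMul ⟨s, hs⟩ hs1)).2
  · rw [CFC.sqrt_eq_real_sqrt (1 - s ^ 2) (by
      rwa [sub_nonneg, ← CStarAlgebra.norm_le_one_iff_of_nonneg (s ^ 2), sq, hs.norm_mul_self,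
        sq_le_one_iff₀ (by positivity)]), cfcₙ_eq_cfc]
    have key : 1 - cfc (√·) (1 - s ^ 2) - (1 / 2 : ℝ) • s ^ 2 =
        cfc (fun x : ℝ => 1 - √(1 - x ^ 2) - (1 / 2 : ℝ) • x ^ 2) s := by
      rw [cfc_sub .., cfc_sub .., cfc_const_one .., cfc_smul .., cfc_pow .., cfc_id' ..,
        cfc_comp' (√·) (1 - · ^ 2) s, cfc_sub .., cfc_pow .., cfc_const_one .., cfc_id' ..]
    rw [key]
    refine norm_cfc_le (by positivity) fun x hx => ?_
    have hxs : |x| ≤ ‖s‖ := spectrum.norm_le_norm_of_mem hx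
    rw [Real.norm_eq_abs, smul_eq_mul, one_div, inv_mul_eq_div]
    exact (abs_one_sub_sqrt_sub_le (hxs.trans hs1)).trans (by gcongr)

/-- A regularised polar decomposition. -/
theorem exists_contraction_mul_selfAdjoint (a : A) {ε : ℝ} (hε : 0 < ε) :
    ∃ v h : A, a = v * h ∧ ‖v‖ ≤ 1 ∧ IsSelfAdjoint h ∧ h ^ 2 = star a * a + ε • (1 : A) := by
  let _ := CStarAlgebra.spectralOrder A
  let _ := CStarAlgebra.spectralOrderedRing A
  obtain (_ | _) := subsingleton_or_nontrivial A
  · exact ⟨0, 0, Subsingleton.elim _ _, by simp, .zero _, Subsingleton.elim _ _⟩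
  have hsa : IsSelfAdjoint (star a * a) := .star_mul_self a
  have hpos : ∀ x : ℝ, 0 < √(|x| + ε) := fun x => Real.sqrt_pos.2 (by positivity)
  have hc : Continuous fun x : ℝ => √(|x| + ε) := by fun_prop
  have hc' : Continuous fun x : ℝ => (√(|x| + ε))⁻¹ := hc.inv₀ fun x => (hpos x).ne'
  have hmem : ∀ x ∈ spectrum ℝ (star a * a), 0 ≤ x := fun x hx =>
    spectrum_nonneg_of_nonneg (star_mul_self_nonneg a) hx
  refine ⟨a * cfc (fun x : ℝ => (√(|x| + ε))⁻¹) (star a * a),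
    cfc (fun x : ℝ => √(|x| + ε)) (star a * a), ?_, ?_, cfc_predicate _ _, ?_⟩
  · rw [mul_assoc, ← cfc_mul _ _ _ hc'.continuousOn hc.continuousOn]
    simp only [inv_mul_cancel₀ (hpos _).ne']
    rw [cfc_const_one .., mul_one]
  · rw [← sq_le_one_iff₀ (norm_nonneg _), sq, ← CStarRing.norm_star_mul_self, star_mul,
      (cfc_predicate (R := ℝ) (p := IsSelfAdjoint) _ _ : IsSelfAdjoint (cfc _ (star a * a))).star_eq,
      mul_assoc, ← mul_assoc (star a)]
    nth_rw 2 [← cfc_id' ℝ (star a * a)]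
    rw [← cfc_mul (fun x : ℝ => x) _ _ continuousOn_id hc'.continuousOn,
      ← cfc_mul _ (fun x : ℝ => x * (√(|x| + ε))⁻¹) _ hc'.continuousOn
        (continuous_id.mul hc').continuousOn]
    refine norm_cfc_le zero_le_one fun x hx => ?_
    have h0 := hmem x hx
    have h1 := Real.sq_sqrt (by positivity : 0 ≤ |x| + ε)
    have h2 := hpos x
    rw [Real.norm_eq_abs, abs_of_nonneg (by positivity)]
    rw [show (√(|x| + ε))⁻¹ * (x * (√(|x| + ε))⁻¹) = x / √(|x| + ε) ^ 2 by field_simp, h1,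
      abs_of_nonneg h0]
    exact (div_le_one (by positivity)).2 (by linarith)
  · rw [← cfc_pow _ 2 _ hc.continuousOn]
    have : cfc (fun x : ℝ => √(|x| + ε) ^ 2) (star a * a) =
        cfc (fun x : ℝ => x + ε) (star a * a) := cfc_congr fun x hx => by
      rw [Real.sq_sqrt (by positivity), abs_of_nonneg (hmem x hx)]
    rw [this, cfc_add .., cfc_id' .., cfc_const .., Algebra.algebraMap_eq_smul_one]

end FunctionalCalculus

/-! ### Domination of a bounded homomorphism by a positive functional. -/

section BoundedHomomorphism

variable {A C : Type*} [CStarAlgebra A] [NonUnitalCStarAlgebra C]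

/-- The functional `x ↦ ρ (φ(u)⋆ φ(u x))`. -/
noncomputable def translatedFunctional (φ : A →L[ℂ] C) (ρ : C →L[ℂ] ℂ) (u : A) : A →L[ℂ] ℂ :=
  ρ.comp ((ContinuousLinearMap.mul ℂ C (star (φ u))).comp
    (φ.comp (ContinuousLinearMap.mul ℂ A u)))

@[simp]
theorem translatedFunctional_apply (φ : A →L[ℂ] C) (ρ : C →L[ℂ] ℂ) (u x : A) :
    translatedFunctional φ ρ u x = ρ (star (φ u) * φ (u * x)) := rfl

theorem norm_le_one_of_mem_unitary {u : A} (hu : u ∈ unitary A) : ‖u‖ ≤ 1 := by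
  obtain (_ | _) := subsingleton_or_nontrivial A
  · simp [Subsingleton.elim u 0]
  · exact (CStarRing.norm_of_mem_unitary hu).le

theorem norm_translatedFunctional_le (φ : A →L[ℂ] C) (ρ : C →L[ℂ] ℂ) {u : A}
    (hu : u ∈ unitary A) : ‖translatedFunctional φ ρ u‖ ≤ ‖ρ‖ * ‖φ‖ ^ 2 := by
  have hu1 := norm_le_one_of_mem_unitary hu
  have h1 : ∀ x : A, ‖x‖ ≤ 1 → ‖φ x‖ ≤ ‖φ‖ := fun x hx =>
    (φ.le_opNorm x).trans (mul_le_of_le_one_right (norm_nonneg _) hx)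
  refine ContinuousLinearMap.opNorm_le_bound _ (by positivity) fun x => ?_
  calc ‖ρ (star (φ u) * φ (u * x))‖ ≤ ‖ρ‖ * (‖star (φ u)‖ * ‖φ (u * x)‖) :=
        (ρ.le_opNorm _).trans (by gcongr; exact norm_mul_le _ _)
    _ ≤ ‖ρ‖ * (‖φ‖ * (‖φ‖ * (1 * ‖x‖))) := by
        rw [norm_star]
        gcongr
        · exact h1 u hu1
        · exact (φ.le_opNorm _).trans (by gcongr; exact (norm_mul_le _ _).trans (by gcongr))
    _ = ‖ρ‖ * ‖φ‖ ^ 2 * ‖x‖ := by ring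

theorem re_apply_add_I_smul (ρ : C →L[ℂ] ℂ) (x y : C) :
    (ρ (star (x + Complex.I • y) * (x + Complex.I • y))).re +
      (ρ (star (x - Complex.I • y) * (x - Complex.I • y))).re =
      2 * ((ρ (star x * x)).re + (ρ (star y * y)).re) := by
  simp [add_mul, mul_add, mul_sub, smul_mul_assoc, mul_smul_comm, smul_smul]
  ring

/-- Second-order variation at `u`: both `u(s ± ic)`, with `c ≈ 1 - s²/2`, are unitary, so the
parallelogram law bounds the sum of the terms of `us` and `uc` by `M`. The term of `uc` is at least
that of `u` minus the functional at `s²`, up to fourth order. -/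
theorem re_apply_map_mul_selfAdjoint_le (φ : A →L[ℂ] C) {ρ : C →L[ℂ] ℂ}
    (hρ : ∀ x, 0 ≤ ρ (star x * x)) {M : ℝ}
    (hM : ∀ w ∈ unitary A, (ρ (star (φ w) * φ w)).re ≤ M) {u : A} (hu : u ∈ unitary A)
    {s : A} (hs : IsSelfAdjoint s) (hs1 : ‖s‖ ≤ 1) :
    (ρ (star (φ (u * s)) * φ (u * s))).re ≤
      (M - (ρ (star (φ u) * φ u)).re) + (translatedFunctional φ ρ u (s ^ 2)).re +
        2 * (‖ρ‖ * ‖φ‖ ^ 2) * ‖s‖ ^ 4 := by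
  obtain ⟨c, hc1, hc2, hc⟩ := exists_unitary_add_smul s hs hs1
  have h1 := hM _ (mul_mem hu hc1)
  have h2 := hM _ (mul_mem hu hc2)
  have h3 := re_apply_add_I_smul ρ (φ (u * s)) (φ (u * c))
  rw [mul_add, mul_smul_comm, map_add, map_smul] at h1
  rw [mul_sub, mul_smul_comm, map_sub, map_smul] at h2
  set r := 1 - c - (1 / 2 : ℝ) • s ^ 2 with hr
  set d := 1 - c with hd
  have hcd : φ (u * c) = φ u - φ (u * d) := by rw [hd, ← map_sub, mul_sub, mul_one, sub_sub_cancel]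
  -- Expand the square of `φ u - φ (u * d)` and drop the nonnegative term in `φ (u * d)`.
  have h4 : (ρ (star (φ (u * c)) * φ (u * c))).re ≥
      (ρ (star (φ u) * φ u)).re - 2 * (translatedFunctional φ ρ u d).re := by
    have h5 := (Complex.nonneg_iff.1 (hρ (φ (u * d)))).1
    have h6 := congrArg Complex.re
      (star_apply_of_nonneg (S := gramForm ρ.toLinearMap .id) hρ (φ u) (φ (u * d)))
    simp only [Complex.star_def, Complex.conj_re, gramForm_apply, LinearMap.id_apply,
      ContinuousLinearMap.coe_coe] at h6
    rw [hcd, translatedFunctional_apply]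
    simp only [star_sub, mul_sub, sub_mul, map_sub, Complex.sub_re]
    linarith
  have h7 : (translatedFunctional φ ρ u d).re =
      (translatedFunctional φ ρ u (s ^ 2)).re / 2 + (translatedFunctional φ ρ u r).re := by
    have : d = (1 / 2 : ℝ) • s ^ 2 + r := by rw [hr]; abel
    rw [this, map_add, Complex.add_re, ← Complex.coe_smul, map_smul]
    simp
    ring
  have h8 : (translatedFunctional φ ρ u r).re ≤ ‖ρ‖ * ‖φ‖ ^ 2 * ‖s‖ ^ 4 :=
    (Complex.re_le_norm _).trans (((translatedFunctional φ ρ u).le_opNorm r).trans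
      (mul_le_mul (norm_translatedFunctional_le φ ρ hu) hc (norm_nonneg _) (by positivity)))
  linarith

/-- Factor `φ(vh) = φ(vu⋆)φ(uh)`; the contraction `vu⋆` costs one factor `‖φ‖²`. -/
theorem re_apply_map_mul_le (φ : A →L[ℂ] C) (hφ : ∀ x y, φ (x * y) = φ x * φ y)
    {ρ : C →L[ℂ] ℂ} (hρ : ∀ x, 0 ≤ ρ (star x * x)) {u : A} (hu : u ∈ unitary A)
    {v : A} (hv : ‖v‖ ≤ 1) (h : A) :
    (ρ (star (φ (v * h)) * φ (v * h))).re ≤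
      ‖φ‖ ^ 2 * (ρ (star (φ (u * h)) * φ (u * h))).re := by
  have e : φ (v * h) = φ (v * star u) * φ (u * h) := by
    rw [← hφ, mul_assoc, ← mul_assoc (star u), Unitary.star_mul_self_of_mem hu, one_mul]
  have h1 : ‖φ (v * star u)‖ ≤ ‖φ‖ := (φ.le_opNorm _).trans
    (mul_le_of_le_one_right (norm_nonneg _) ((norm_mul_le _ _).trans
      (mul_le_one₀ hv (norm_nonneg _) (norm_le_one_of_mem_unitary (Unitary.star_mem hu)))))
  have h2 := (Complex.le_def.1 (apply_star_mul_self_mul_le hρ (φ (v * star u)) (φ (u * h)))).1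
  rw [Complex.re_ofReal_mul] at h2
  rw [e]
  refine h2.trans (mul_le_mul_of_nonneg_right (by gcongr) (Complex.nonneg_iff.1 (hρ _)).1)

theorem exists_dominating_functional_re (φ : A →L[ℂ] C) (hφ : ∀ x y, φ (x * y) = φ x * φ y)
    {ρ : C →L[ℂ] ℂ} (hρ : ∀ x, 0 ≤ ρ (star x * x)) :
    ∃ G : A →L[ℂ] ℂ, (G 1).re ≤ ‖ρ‖ * ‖φ‖ ^ 2 ∧
      ∀ a, (ρ (star (φ a) * φ a)).re ≤ ‖φ‖ ^ 2 * (G (star a * a)).re := by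
  set K := ‖ρ‖ * ‖φ‖ ^ 2 with hK
  let N : unitary A → ℝ := fun u => (ρ (star (φ u) * φ u)).re
  have hNK : ∀ u, N u ≤ K := fun u => (re_apply_star_mul_self_le _).trans <| by
    have := (φ.le_opNorm u).trans
      (mul_le_of_le_one_right (norm_nonneg _) (norm_le_one_of_mem_unitary u.2))
    exact mul_le_mul_of_nonneg_left (pow_le_pow_left₀ (norm_nonneg _) this 2) (norm_nonneg _)
  have hbdd : BddAbove (Set.range N) := ⟨K, by rintro _ ⟨u, rfl⟩; exact hNK u⟩
  set M := ⨆ u, N u with hMdef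
  have hM : ∀ w ∈ unitary A, (ρ (star (φ w) * φ w)).re ≤ M := fun w hw =>
    le_ciSup hbdd ⟨w, hw⟩
  have hu : ∀ n : ℕ, ∃ u : unitary A, M - 1 / ((n : ℝ) + 1) < N u := fun n =>
    exists_lt_of_lt_ciSup (sub_lt_self _ (by positivity))
  choose u hu using hu
  let Gn : ℕ → A →L[ℂ] ℂ := fun n => translatedFunctional φ ρ (u n)
  have hcpt := WeakDual.isCompact_closedBall (0 : StrongDual ℂ A) K
  -- Banach–Alaoglu along an ultrafilter: no separability is needed to obtain a limit.
  obtain ⟨G, -, hG⟩ := hcpt.ultrafilter_le_nhds'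
    ((hyperfilter ℕ).map fun n => StrongDual.toWeakDual (Gn n))
    (Filter.mem_map.2 (Filter.univ_mem' fun n => by
      simpa [Gn] using norm_translatedFunctional_le φ ρ (u n).2))
  have hlim : ∀ x, Tendsto (fun n => (Gn n x).re) (hyperfilter ℕ) (𝓝 (G x).re) := fun x =>
    (Complex.continuous_re.tendsto _).comp
      (((WeakDual.eval_continuous x).tendsto G).comp hG)
  have hzero : Tendsto (fun n : ℕ => 1 / ((n : ℝ) + 1)) (hyperfilter ℕ) (𝓝 0) :=
    tendsto_one_div_add_atTop_nhds_zero_nat.mono_left Nat.hyperfilter_le_atTop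
  refine ⟨WeakDual.toStrongDual G, ?_, fun a => ?_⟩
  · refine le_of_tendsto' (hlim 1) fun n => ?_
    simpa [Gn] using hNK (u n)
  have main : ∀ ε : ℝ, 0 < ε → (ρ (star (φ a) * φ a)).re ≤
      ‖φ‖ ^ 2 * ((G (star a * a)).re + ε * (G 1).re) := by
    intro ε hε
    obtain ⟨v, h, hvh, hv, hh, hh2⟩ := exists_contraction_mul_selfAdjoint a hε
    have hGh : (G (star a * a)).re + ε * (G 1).re = (G (h ^ 2)).re := by
      rw [hh2, map_add, ← Complex.coe_smul, map_smul]
      simp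
    rw [hGh]
    -- Scale `h` to `th`. The defect `M - N (u n)` vanishes as `n → ∞` with `t` fixed; division by
    -- `t²` leaves an error of order `t²`, removed afterwards by `t → 0`.
    have small : ∀ t : ℝ, 0 < t → t * ‖h‖ ≤ 1 → (ρ (star (φ a) * φ a)).re ≤
        ‖φ‖ ^ 2 * ((G (h ^ 2)).re + 2 * K * ‖h‖ ^ 4 * t ^ 2) := by
      intro t ht hth
      have step : ∀ n : ℕ, t ^ 2 * (ρ (star (φ a) * φ a)).re ≤ ‖φ‖ ^ 2 * (1 / ((n : ℝ) + 1) +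
          t ^ 2 * (Gn n (h ^ 2)).re + 2 * K * (t * ‖h‖) ^ 4) := by
        intro n
        have hnorm : ‖t • h‖ = t * ‖h‖ := by rw [norm_smul, Real.norm_of_nonneg ht.le]
        have h1 := re_apply_map_mul_le φ hφ hρ (u n).2 hv h
        have h2 := re_apply_map_mul_selfAdjoint_le φ hρ hM (u n).2
          ((IsSelfAdjoint.all t).smul hh) (hnorm.le.trans hth)
        rw [hnorm, smul_pow, mul_smul_comm, ← Complex.coe_smul t, ← Complex.coe_smul (t ^ 2),
          map_smul, map_smul, star_smul, smul_mul_smul_comm, map_smul] at h2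
        have e : (star (t : ℂ) * t) = ((t ^ 2 : ℝ) : ℂ) := by simp [sq]
        rw [e, smul_eq_mul, smul_eq_mul, Complex.re_ofReal_mul, Complex.re_ofReal_mul] at h2
        have h3 := hu n
        rw [← hvh] at h1
        calc t ^ 2 * (ρ (star (φ a) * φ a)).re
            ≤ ‖φ‖ ^ 2 * (t ^ 2 * (ρ (star (φ (u n * h)) * φ (u n * h))).re) := by
              rw [mul_left_comm]; gcongr
          _ ≤ _ := by
              gcongr
              exact h2.trans (by gcongr; linarith)
      have hl := ge_of_tendsto' (((hzero.add ((hlim (h ^ 2)).const_mul (t ^ 2))).add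
        tendsto_const_nhds).const_mul (‖φ‖ ^ 2)) step
      refine le_of_mul_le_mul_left (hl.trans_eq ?_) (by positivity : 0 < t ^ 2)
      ring
    have ht : Tendsto (fun t : ℝ => ‖φ‖ ^ 2 * ((G (h ^ 2)).re + 2 * K * ‖h‖ ^ 4 * t ^ 2))
        (𝓝[>] 0) (𝓝 (‖φ‖ ^ 2 * (G (h ^ 2)).re)) := by
      refine (Continuous.tendsto' (by fun_prop) _ _ (by simp)).mono_left nhdsWithin_le_nhds
    refine ge_of_tendsto ht ?_
    have hsm : ∀ᶠ t : ℝ in 𝓝 0, t * ‖h‖ < 1 :=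
      (Continuous.tendsto' (by fun_prop : Continuous fun t : ℝ => t * ‖h‖) 0 0
        (by simp)).eventually_lt_const one_pos
    filter_upwards [self_mem_nhdsWithin, nhdsWithin_le_nhds hsm] with t ht1 ht2
    exact small t ht1 ht2.le
  have hε : Tendsto (fun ε : ℝ => ‖φ‖ ^ 2 * ((G (star a * a)).re + ε * (G 1).re))
      (𝓝[>] 0) (𝓝 (‖φ‖ ^ 2 * (G (star a * a)).re)) :=
    (Continuous.tendsto' (by fun_prop) _ _ (by simp)).mono_left nhdsWithin_le_nhds
  exact ge_of_tendsto hε (eventually_nhdsWithin_of_forall main)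

/-- A bounded homomorphism `φ` is dominated in the semi-norm of a positive functional by a
positive functional `G` on its domain, so that `a ↦ φ a` is bounded on columns. -/
theorem exists_dominating_functional (φ : A →L[ℂ] C) (hφ : ∀ x y, φ (x * y) = φ x * φ y)
    {ρ : C →L[ℂ] ℂ} (hρ : ∀ x, 0 ≤ ρ (star x * x)) :
    ∃ G : A →L[ℂ] ℂ, (∀ a, 0 ≤ G (star a * a)) ∧ (G 1).re ≤ ‖ρ‖ * ‖φ‖ ^ 2 ∧
      ∀ a, ρ (star (φ a) * φ a) ≤ (‖φ‖ ^ 2 : ℝ) * G (star a * a) := by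
  obtain ⟨G, hG1, hG⟩ := exists_dominating_functional_re φ hφ hρ
  obtain h0 | h0 := eq_or_ne φ 0
  · exact ⟨0, by simp, by simp [h0], by simp [h0]⟩
  -- Only the real part of `G` is controlled, so `G` is replaced by its hermitian part. Positivity
  -- then follows from the domination, since `φ ≠ 0`.
  let G' : A →L[ℂ] ℂ := (1 / 2 : ℂ) • (G + ((starL ℂ : ℂ ≃L⋆[ℂ] ℂ) : ℂ →L⋆[ℂ] ℂ).comp
    (G.comp ((starL ℂ : A ≃L⋆[ℂ] A) : A →L⋆[ℂ] A)))
  have hG' : ∀ x, IsSelfAdjoint x → G' x = (G x).re := fun x hx => by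
    have : G' x = (1 / 2 : ℂ) * (G x + star (G (star x))) := rfl
    rw [this, hx.star_eq]
    apply Complex.ext <;> simp
    ring
  have hpos : 0 < ‖φ‖ ^ 2 := by positivity
  refine ⟨G', fun a => ?_, ?_, fun a => ?_⟩
  · rw [hG' _ (.star_mul_self a)]
    exact_mod_cast nonneg_of_mul_nonneg_right
      ((Complex.nonneg_iff.1 (hρ (φ a))).1.trans (hG a)) hpos
  · rw [hG' _ (.one A)]
    simpa using hG1
  · rw [hG' _ (.star_mul_self a), Complex.le_def]
    refine ⟨by simpa [-Complex.ofReal_pow] using hG a, ?_⟩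
    rw [← (Complex.nonneg_iff.1 (hρ (φ a))).2, ← Complex.ofReal_mul, Complex.ofReal_im]

end BoundedHomomorphism

/-! ### The C⋆-seminorm of left multiplication. -/

section LeftRegular

variable {D : Type*} [NonUnitalRing D] [StarRing D] [Module ℂ D] [IsScalarTower ℂ D D]
  [SMulCommClass ℂ D D] [StarModule ℂ D]

/-- The operator norm of left multiplication, for the pre-Hilbert structure given by a positive
functional for which all left multiplications are bounded. -/
theorem exists_leftRegular_seminorm (ω : D →ₗ[ℂ] ℂ) (hω : ∀ x, 0 ≤ ω (star x * x))
    (hbdd : ∀ y, ∃ C : ℝ, ∀ z,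
      (ω (star (y * z) * (y * z))).re ≤ C * (ω (star z * z)).re) :
    ∃ q : Seminorm ℂ D, (∀ x y, q (x * y) ≤ q x * q y) ∧ (∀ x, q (star x * x) = q x ^ 2) ∧
      ∀ y z, (ω (star (y * z) * (y * z))).re ≤ q y ^ 2 * (ω (star z * z)).re := by
  let core : PreInnerProductSpace.Core ℂ D :=
    { inner := fun x y => ω (star x * y)
      conj_inner_symm := fun x y => star_apply_of_nonneg (S := gramForm ω .id) hω y x
      re_inner_nonneg := fun x => (Complex.nonneg_iff.1 (hω x)).1
      add_left := fun x y z => by simp [add_mul]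
      smul_left := fun x y r => by simp [smul_mul_assoc] }
  let _ : SeminormedAddCommGroup D := InnerProductSpace.Core.toSeminormedAddCommGroup (c := core)
  let _ : InnerProductSpace ℂ D := InnerProductSpace.ofCore core
  have hnorm : ∀ x : D, (ω (star x * x)).re = ‖x‖ ^ 2 := fun x =>
    (inner_self_eq_norm_sq (𝕜 := ℂ) x)
  have hinner : ∀ x y : D, inner ℂ x y = ω (star x * y) := fun _ _ => rfl
  have hL : ∀ y : D, ∃ C : ℝ, ∀ z, ‖LinearMap.mulLeft ℂ y z‖ ≤ C * ‖z‖ := fun y => by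
    obtain ⟨C, hC⟩ := hbdd y
    -- The given constant may be negative, hence the truncation at `0`.
    refine ⟨√(max C 0), fun z => ?_⟩
    refine le_of_sq_le_sq ?_ (by positivity)
    rw [mul_pow, Real.sq_sqrt (le_max_right _ _), LinearMap.mulLeft_apply, ← hnorm, ← hnorm]
    exact (hC z).trans (mul_le_mul_of_nonneg_right (le_max_left _ _)
      (Complex.nonneg_iff.1 (hω z)).1)
  let L : D →ₗ[ℂ] D →L[ℂ] D :=
    { toFun := fun y => (LinearMap.mulLeft ℂ y).mkContinuousOfExistsBound (hL y)
      map_add' := fun x y => by ext z; exact add_mul x y z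
      map_smul' := fun c y => by ext z; exact smul_mul_assoc c y z }
  have hLz : ∀ y z, L y z = y * z := fun _ _ => rfl
  have hmul : ∀ x y, ‖L (x * y)‖ ≤ ‖L x‖ * ‖L y‖ := fun x y => by
    have : L (x * y) = (L x).comp (L y) := by ext z; exact mul_assoc x y z
    rw [this]
    exact ContinuousLinearMap.opNorm_comp_le _ _
  -- Cauchy–Schwarz: `‖xz‖² = ⟨z, x⋆xz⟩`. Together with submultiplicativity this gives `‖L x‖ ≤ ‖L
  -- x⋆‖`, and so the C⋆-identity, without completing to a Hilbert space.
  have hsq : ∀ x, ‖L x‖ ^ 2 ≤ ‖L (star x * x)‖ := fun x => by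
    refine (Real.le_sqrt (L x).opNorm_nonneg (L (star x * x)).opNorm_nonneg).1 ?_
    refine ContinuousLinearMap.opNorm_le_bound _ (Real.sqrt_nonneg _) fun z => ?_
    refine le_of_sq_le_sq ?_ (by positivity)
    rw [mul_pow, Real.sq_sqrt (L (star x * x)).opNorm_nonneg, hLz, ← hnorm, star_mul, mul_assoc, ← mul_assoc,
      ← mul_assoc]
    calc (ω (star z * star x * x * z)).re = (inner ℂ z (L (star x * x) z)).re := by
          rw [hinner, hLz]; simp only [mul_assoc]
      _ ≤ ‖z‖ * ‖L (star x * x) z‖ := re_inner_le_norm (𝕜 := ℂ) _ _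
      _ ≤ ‖z‖ * (‖L (star x * x)‖ * ‖z‖) := by gcongr; exact ContinuousLinearMap.le_opNorm _ _
      _ = ‖L (star x * x)‖ * ‖z‖ ^ 2 := by ring
  have hstar : ∀ x, ‖L x‖ ≤ ‖L (star x)‖ := fun x => by
    by_contra! h
    have h1 := (hsq x).trans (hmul (star x) x)
    nlinarith [(L (star x)).opNorm_nonneg]
  refine ⟨(normSeminorm ℂ (D →L[ℂ] D)).comp L, hmul, fun x => ?_, fun y z => ?_⟩
  · refine le_antisymm ((hmul _ _).trans ?_) (hsq x)
    rw [sq]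
    have := hstar (star x)
    rw [star_star] at this
    exact mul_le_mul_of_nonneg_right this (L x).opNorm_nonneg
  · rw [hnorm, hnorm, ← mul_pow]
    exact pow_le_pow_left₀ (norm_nonneg _) ((L y).le_opNorm z) 2

end LeftRegular

/-! ### Product functionals and the unique C⋆-norm. -/

section TensorProduct

variable {A B : Type*} [NonUnitalCStarAlgebra A] [NonUnitalCStarAlgebra B]

theorem tensorFunctional_star_sum_mul_sum (ρ₁ : A →L[ℂ] ℂ) (ρ₂ : B →L[ℂ] ℂ) {n : ℕ}
    (a : Fin n → A) (b : Fin n → B) :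
    tensorFunctional ρ₁ ρ₂ (star (∑ i, a i ⊗ₜ[ℂ] b i) * ∑ i, a i ⊗ₜ[ℂ] b i) =
      ∑ i, ∑ j, ρ₁ (star (a i) * a j) * ρ₂ (star (b i) * b j) := by
  simp [tensorFunctional, Finset.sum_mul_sum, TensorProduct.star_tmul,
    Algebra.TensorProduct.tmul_mul_tmul]

theorem tensorFunctional_star_mul_self_nonneg {ρ₁ : A →L[ℂ] ℂ} {ρ₂ : B →L[ℂ] ℂ}
    (h₁ : ∀ x, 0 ≤ ρ₁ (star x * x)) (h₂ : ∀ x, 0 ≤ ρ₂ (star x * x)) (X : A ⊗[ℂ] B) :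
    0 ≤ tensorFunctional ρ₁ ρ₂ (star X * X) := by
  obtain ⟨n, a, b, rfl⟩ := TensorProduct.exists_sum_tmul_eq X
  rw [tensorFunctional_star_sum_mul_sum]
  exact sum_sum_mul_nonneg (S := gramForm ρ₁.toLinearMap .id) (T := gramForm ρ₂.toLinearMap .id)
    h₁ h₂ a b

/-- The two factors are removed one at a time; each step is the Schur product of a positive
difference of forms with a positive form. -/
theorem tensorFunctional_tmul_mul_le {ρ₁ : A →L[ℂ] ℂ} {ρ₂ : B →L[ℂ] ℂ}
    (h₁ : ∀ x, 0 ≤ ρ₁ (star x * x)) (h₂ : ∀ x, 0 ≤ ρ₂ (star x * x)) (a : A) (b : B)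
    (X : A ⊗[ℂ] B) :
    tensorFunctional ρ₁ ρ₂ (star (a ⊗ₜ b * X) * (a ⊗ₜ b * X)) ≤
      ((‖a‖ ^ 2 : ℝ) * (‖b‖ ^ 2 : ℝ) : ℂ) * tensorFunctional ρ₁ ρ₂ (star X * X) := by
  obtain ⟨n, x, y, rfl⟩ := TensorProduct.exists_sum_tmul_eq X
  have e : a ⊗ₜ[ℂ] b * ∑ i, x i ⊗ₜ[ℂ] y i = ∑ i, (a * x i) ⊗ₜ[ℂ] (b * y i) := by
    simp only [Finset.mul_sum, Algebra.TensorProduct.tmul_mul_tmul]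
  rw [e, tensorFunctional_star_sum_mul_sum, tensorFunctional_star_sum_mul_sum]
  have hS := sum_sum_mul_nonneg
    (S := ((‖a‖ ^ 2 : ℝ) : ℂ) • gramForm ρ₁.toLinearMap .id -
      gramForm ρ₁.toLinearMap (LinearMap.mulLeft ℂ a))
    (fun x => by simpa using apply_star_mul_self_mul_le h₁ a x)
    (T := gramForm ρ₂.toLinearMap (LinearMap.mulLeft ℂ b)) (fun x => h₂ _) x y
  have hT := sum_sum_mul_nonneg (S := ((‖a‖ ^ 2 : ℝ) : ℂ) • gramForm ρ₁.toLinearMap .id)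
    (fun x => mul_nonneg (by simp) (h₁ x))
    (T := ((‖b‖ ^ 2 : ℝ) : ℂ) • gramForm ρ₂.toLinearMap .id -
      gramForm ρ₂.toLinearMap (LinearMap.mulLeft ℂ b))
    (fun x => by simpa using apply_star_mul_self_mul_le h₂ b x) x y
  simp only [LinearMap.sub_apply, LinearMap.smul_apply, gramForm_apply, LinearMap.id_apply,
    LinearMap.mulLeft_apply, ContinuousLinearMap.coe_coe, smul_eq_mul, sub_mul, mul_sub,
    Finset.sum_sub_distrib, sub_nonneg] at hS hT
  refine hS.trans (hT.trans_eq ?_)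
  simp only [Finset.mul_sum]
  exact Finset.sum_congr rfl fun i _ => Finset.sum_congr rfl fun j _ => by ring

theorem exists_tensorFunctional_mul_le {ρ₁ : A →L[ℂ] ℂ} {ρ₂ : B →L[ℂ] ℂ}
    (h₁ : ∀ x, 0 ≤ ρ₁ (star x * x)) (h₂ : ∀ x, 0 ≤ ρ₂ (star x * x)) (Y : A ⊗[ℂ] B) :
    ∃ C : ℝ, ∀ X, (tensorFunctional ρ₁ ρ₂ (star (Y * X) * (Y * X))).re ≤
      C * (tensorFunctional ρ₁ ρ₂ (star X * X)).re := by
  have hpos := tensorFunctional_star_mul_self_nonneg h₁ h₂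
  induction Y with
  | zero => exact ⟨0, fun X => by simp⟩
  | tmul a b =>
    refine ⟨‖a‖ ^ 2 * ‖b‖ ^ 2, fun X => ?_⟩
    have := (Complex.le_def.1 (tensorFunctional_tmul_mul_le h₁ h₂ a b X)).1
    rwa [← Complex.ofReal_mul, Complex.re_ofReal_mul] at this
  | add Y Z hY hZ =>
    obtain ⟨C, hC⟩ := hY
    obtain ⟨C', hC'⟩ := hZ
    refine ⟨2 * (C + C'), fun X => ?_⟩
    -- Positivity at the difference gives `|y + z|² ≤ 2|y|² + 2|z|²`.
    have h := (Complex.nonneg_iff.1 (hpos (Y * X - Z * X))).1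
    have h1 := hC X
    have h2 := hC' X
    simp only [add_mul, mul_add, star_add, star_sub, sub_mul, mul_sub, map_add, map_sub,
      Complex.add_re, Complex.sub_re] at h ⊢
    linarith

/-- If there is exactly one C⋆-norm, it dominates the operator norm of left multiplication for
every positive product functional. -/
theorem IsCStarNorm.tensorFunctional_mul_le {p : Seminorm ℂ (A ⊗[ℂ] B)} (hp : IsCStarNorm p)
    (huniq : ∀ q : Seminorm ℂ (A ⊗[ℂ] B), IsCStarNorm q → q = p)
    {ρ₁ : A →L[ℂ] ℂ} {ρ₂ : B →L[ℂ] ℂ}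
    (h₁ : ∀ x, 0 ≤ ρ₁ (star x * x)) (h₂ : ∀ x, 0 ≤ ρ₂ (star x * x)) (Y Z : A ⊗[ℂ] B) :
    (tensorFunctional ρ₁ ρ₂ (star (Y * Z) * (Y * Z))).re ≤
      p Y ^ 2 * (tensorFunctional ρ₁ ρ₂ (star Z * Z)).re := by
  obtain ⟨q, hqm, hqs, hq⟩ := exists_leftRegular_seminorm (tensorFunctional ρ₁ ρ₂)
    (tensorFunctional_star_mul_self_nonneg h₁ h₂) (exists_tensorFunctional_mul_le h₁ h₂)
  -- `q` itself may be degenerate; the supremum is definite because `p` is.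
  have hsup : IsCStarNorm (p ⊔ q) :=
    { eq_zero_of_apply_eq_zero := fun x hx => hp.eq_zero_of_apply_eq_zero x <|
        le_antisymm (le_sup_left.trans_eq hx) (apply_nonneg p x)
      mul_le := fun x y => sup_le
        ((hp.mul_le x y).trans (mul_le_mul le_sup_left le_sup_left (apply_nonneg _ _)
          ((apply_nonneg p x).trans le_sup_left)))
        ((hqm x y).trans (mul_le_mul le_sup_right le_sup_right (apply_nonneg _ _)
          ((apply_nonneg p x).trans le_sup_left)))
      star_mul_self := fun x => by
        simp only [Seminorm.sup_apply, hp.star_mul_self, hqs]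
        exact ((pow_left_monotoneOn (n := 2)).map_max (apply_nonneg p x) (apply_nonneg q x)).symm }
  have hqp : q Y ≤ p Y := by
    conv_rhs => rw [← huniq _ hsup]
    exact le_sup_right
  refine (hq Y Z).trans (mul_le_mul_of_nonneg_right ?_
    (Complex.nonneg_iff.1 (tensorFunctional_star_mul_self_nonneg h₁ h₂ Z)).1)
  exact pow_le_pow_left₀ (apply_nonneg q Y) hqp 2

end TensorProduct

/-! ### Bounds with a unital first factor. -/

section UnitalTensorProduct

variable {A B : Type*} [CStarAlgebra A] [NonUnitalCStarAlgebra B]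

/-- As `B` may lack a unit, the left multiplication bound is tested on `1 ⊗ e` and `e` runs through
an approximate unit of `B`. -/
theorem IsCStarNorm.tensorFunctional_le {p : Seminorm ℂ (A ⊗[ℂ] B)} (hp : IsCStarNorm p)
    (huniq : ∀ q : Seminorm ℂ (A ⊗[ℂ] B), IsCStarNorm q → q = p)
    {ρ₁ : A →L[ℂ] ℂ} {ρ₂ : B →L[ℂ] ℂ}
    (h₁ : ∀ x, 0 ≤ ρ₁ (star x * x)) (h₂ : ∀ x, 0 ≤ ρ₂ (star x * x)) (Y : A ⊗[ℂ] B) :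
    (tensorFunctional ρ₁ ρ₂ (star Y * Y)).re ≤ p Y ^ 2 * ((ρ₁ 1).re * ‖ρ₂‖) := by
  let _ := CStarAlgebra.spectralOrder B
  let _ := CStarAlgebra.spectralOrderedRing B
  obtain ⟨n, a, b, rfl⟩ := TensorProduct.exists_sum_tmul_eq Y
  have hl := CStarAlgebra.increasingApproximateUnit B
  have hone := Complex.nonneg_iff.1 (h₁ 1)
  rw [star_one, one_mul] at hone
  have hlim : Tendsto (fun e : B => (∑ i, ∑ j, ρ₁ (star (a i) * a j) *
      ρ₂ (star (b i * e) * (b j * e))).re) (CStarAlgebra.approximateUnit B)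
      (𝓝 (∑ i, ∑ j, ρ₁ (star (a i) * a j) * ρ₂ (star (b i) * b j)).re) := by
    refine (Complex.continuous_re.tendsto _).comp (tendsto_finsetSum _ fun i _ =>
      tendsto_finsetSum _ fun j _ => Tendsto.const_mul _ ((ρ₂.continuous.tendsto _).comp ?_))
    exact ((continuous_star.tendsto _).comp (hl.tendsto_mul_left (b i))).mul
      (hl.tendsto_mul_left (b j))
  rw [tensorFunctional_star_sum_mul_sum]
  refine le_of_tendsto hlim ?_
  filter_upwards [hl.eventually_norm] with e he
  have h := hp.tensorFunctional_mul_le huniq h₁ h₂ (∑ i, a i ⊗ₜ[ℂ] b i) (1 ⊗ₜ e)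
  simp only [Finset.sum_mul, Algebra.TensorProduct.tmul_mul_tmul, mul_one] at h
  rw [tensorFunctional_star_sum_mul_sum] at h
  refine h.trans (mul_le_mul_of_nonneg_left ?_ (sq_nonneg _))
  have he2 : (ρ₂ (star e * e)).re ≤ ‖ρ₂‖ := (re_apply_star_mul_self_le e).trans
    (mul_le_of_le_one_right (norm_nonneg _) (pow_le_one₀ (norm_nonneg e) he))
  simp only [tensorFunctional, TensorProduct.star_tmul, Algebra.TensorProduct.tmul_mul_tmul,
    LinearMap.comp_apply, TensorProduct.map_tmul, LinearMap.mul'_apply, star_one, one_mul,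
    ContinuousLinearMap.coe_coe, Complex.mul_re, ← hone.2, zero_mul, sub_zero]
  exact mul_le_mul_of_nonneg_left he2 hone.1

theorem tensorFunctional_map_le {C : Type*} [NonUnitalCStarAlgebra C] (φ : A →L[ℂ] C)
    {ρ₁ : C →L[ℂ] ℂ} {G : A →L[ℂ] ℂ} {K : ℝ}
    (hG : ∀ a, ρ₁ (star (φ a) * φ a) ≤ K * G (star a * a)) {ρ₂ : B →L[ℂ] ℂ}
    (h₂ : ∀ x, 0 ≤ ρ₂ (star x * x)) {n : ℕ} (a : Fin n → A) (b : Fin n → B) :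
    tensorFunctional ρ₁ ρ₂ (star (∑ i, φ (a i) ⊗ₜ[ℂ] b i) * ∑ i, φ (a i) ⊗ₜ[ℂ] b i) ≤
      K * tensorFunctional G ρ₂ (star (∑ i, a i ⊗ₜ[ℂ] b i) * ∑ i, a i ⊗ₜ[ℂ] b i) := by
  rw [tensorFunctional_star_sum_mul_sum, tensorFunctional_star_sum_mul_sum]
  have h := sum_sum_mul_nonneg
    (S := (K : ℂ) • gramForm G.toLinearMap .id - gramForm ρ₁.toLinearMap φ.toLinearMap)
    (fun x => by simpa using hG x) (T := gramForm ρ₂.toLinearMap .id) h₂ a b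
  simp only [LinearMap.sub_apply, LinearMap.smul_apply, gramForm_apply, LinearMap.id_apply,
    ContinuousLinearMap.coe_coe, smul_eq_mul, sub_mul, Finset.sum_sub_distrib, sub_nonneg] at h
  simpa only [Finset.mul_sum, mul_assoc] using h

/-- `φ 1` is a nonzero idempotent, and a nonzero idempotent has norm at least one. -/
theorem one_le_norm_of_map_mul {C : Type*} [NonUnitalCStarAlgebra C] {φ : A →L[ℂ] C}
    (hφ : ∀ x y, φ (x * y) = φ x * φ y) (h0 : φ ≠ 0) : 1 ≤ ‖φ‖ := by
  have h1 : φ 1 ≠ 0 := fun h => h0 <| by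
    ext x
    rw [← mul_one x, hφ, h, mul_zero, zero_apply]
  have h2 : ‖φ 1‖ ≤ ‖φ‖ := (φ.le_opNorm 1).trans
    (mul_le_of_le_one_right (norm_nonneg _) (norm_le_one_of_mem_unitary (one_mem _)))
  have h3 : ‖φ 1‖ ≤ ‖φ 1‖ * ‖φ 1‖ := by
    conv_lhs => rw [← mul_one (1 : A), hφ]
    exact norm_mul_le _ _
  exact ((le_mul_iff_one_le_right (norm_pos_iff.2 h1)).1 h3).trans h2

end UnitalTensorProduct

/-! ### The main inequality. -/

theorem mainTheorem9 {B : Type*} [NonUnitalCStarAlgebra B] (hB : IsNuclear B)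
    (ρ₁ : BEllTwo →L[ℂ] ℂ) (hρ₁ : IsState ρ₁)
    (ρ₂ : B →L[ℂ] ℂ) (hρ₂ : IsState ρ₂)
    (φ : CStarFreeInf →L[ℂ] BEllTwo) (hφ : ∀ x y, φ (x * y) = φ x * φ y)
    (p : Seminorm ℂ (CStarFreeInf ⊗[ℂ] B)) (hp : IsCStarNorm p)
    (n : ℕ) (a : Fin n → CStarFreeInf) (b : Fin n → B)
    (X : BEllTwo ⊗[ℂ] B) (hX : X = ∑ i, φ (a i) ⊗ₜ[ℂ] b i) :
    0 ≤ tensorFunctional ρ₁ ρ₂ (star X * X) ∧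
      Real.sqrt (tensorFunctional ρ₁ ρ₂ (star X * X)).re ≤
        ‖φ‖ ^ 3 * p (∑ i, a i ⊗ₜ[ℂ] b i) := by
  subst hX
  have hpos := tensorFunctional_star_mul_self_nonneg hρ₁.nonneg hρ₂.nonneg
    (∑ i, φ (a i) ⊗ₜ[ℂ] b i)
  refine ⟨hpos, ?_⟩
  obtain rfl | h0 := eq_or_ne φ 0
  · have h : 0 ≤ ‖(0 : CStarFreeInf →L[ℂ] BEllTwo)‖ ^ 3 * p (∑ i, a i ⊗ₜ[ℂ] b i) :=
      mul_nonneg (by positivity) (apply_nonneg p _)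
    rw [tensorFunctional_star_sum_mul_sum]
    simpa using! h
  obtain ⟨G, hG, hG1, hφG⟩ := exists_dominating_functional φ hφ hρ₁.nonneg
  rw [hρ₁.norm_eq_one, one_mul] at hG1
  have huniq : ∀ q : Seminorm ℂ (CStarFreeInf ⊗[ℂ] B), IsCStarNorm q → q = p :=
    fun q hq => (hB CStarFreeInf).unique hq hp
  have h1 := (Complex.le_def.1 (tensorFunctional_map_le φ hφG hρ₂.nonneg a b)).1
  have h2 := hp.tensorFunctional_le huniq hG hρ₂.nonneg (∑ i, a i ⊗ₜ[ℂ] b i)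
  rw [Complex.re_ofReal_mul] at h1
  rw [hρ₂.norm_eq_one, mul_one] at h2
  set P := p (∑ i, a i ⊗ₜ[ℂ] b i)
  have hP : 0 ≤ P := apply_nonneg p _
  refine Real.sqrt_le_iff.2 ⟨by positivity, ?_⟩
  calc _ ≤ ‖φ‖ ^ 2 * (P ^ 2 * ‖φ‖ ^ 2) := h1.trans (by gcongr; exact h2.trans (by gcongr))
    _ = ‖φ‖ ^ 4 * P ^ 2 := by ring
    -- The argument yields the exponent `2` after the square root; `1 ≤ ‖φ‖` raises it to `3`.
    _ ≤ ‖φ‖ ^ 6 * P ^ 2 := by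
      gcongr
      · exact one_le_norm_of_map_mul hφ h0
      · norm_num
    _ = (‖φ‖ ^ 3 * P) ^ 2 := by ring
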